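/- Let $\mathcal{M}$ be a regular matroid on a finite ground set $E$, represented over $\mathbb{R}$ by the columns, indexed by $E$, of a totally unimodular matrix $M$. A signed circuit (resp. signed cocircuit) of $\mathcal{M}$ is a $\{0,\pm1\}$-vector in $\ker_{\mathbb{R}}(M)$ (resp. in $\operatorname{im}_{\mathbb{R}}(M^T)$) whose support is a circuit (resp. a cocircuit) of $\mathcal{M}$. An arc is an edge $e\in E$ with a sign $\pm$; a signed circuit or cocircuit is identified with the set of arcs given by its nonzero entries. An orientation of $\mathcal{M}$ is a set of arcs containing exactly one of the two arcs of each edge. A circuit reversal replaces a signed circuit $\overrightarrow{C}$ contained in an orientation by $-\overrightarrow{C}$; a cocircuit reversal is defined similarly. The circuit reversal classes, the cocircuit reversal classes and the circuit-cocircuit reversal classes are the classes of the equivalence relations on orientations generated by circuit reversals, by cocircuit reversals, and by both kinds of reversals, respectively. A circuit signature $\sigma$ (resp. cocircuit signature $\sigma^*$) is the choice, for each circuit (resp. cocircuit), of one signed circuit (resp. signed cocircuit) supported on it; it is also viewed as the set of chosen vectors. For a basis $B$, let $\overrightarrow{B}_\sigma$ be the set of arcs consisting of both arcs of each $e\in B$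 and, for each $e\notin B$, the arc of $e$ in the signed circuit chosen by $\sigma$ for the fundamental circuit $C(B,e)$, i.e. the unique circuit in $B\cup\{e\}$. Let $\overrightarrow{B}^*_{\sigma^*}$ be the set of arcs consisting of both arcs of each $e\notin B$ and, for each $e\in B$, the arc of $e$ in the signed cocircuit chosen by $\sigma^*$ for the fundamental cocircuit $C^*(B,e)$, i.e. the unique cocircuit in $(E\setminus B)\cup\{e\}$. The signature $\sigma$ is triangulating if, for every basis $B$, every signed circuit contained in $\overrightarrow{B}_\sigma$ is in $\sigma$; the signature $\sigma^*$ is triangulating if, for every basis $B$, every signed cocircuit contained in $\overrightarrow{B}^*_{\sigma^*}$ is in $\sigma^*$. An orientation is $\sigma$-compatible if every signed circuit contained in it is in $\sigma$, $\sigma^*$-compatible if every signed cocircuit contained in it is in $\sigma^*$, and $(\sigma,\sigma^*)$-compatible if it is both. Then: 1. If $\sigma$ and $\sigma^*$ are triangulating, every circuit-cocircuit reversal class of orientations of $\mathcal{M}$ contains exactly one $(\sigma,\sigma^*)$-compatible orientation. 2. If $\sigma$ is triangulating, every circuit reversal class contains exactly one $\sigma$-compatible orientation. 3. If $\sigma^*$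 is triangulating, every cocircuit reversal class contains exactly one $\sigma^*$-compatible orientation. -/

import Mathlib

open Set

namespace RegularMatroid

/-- An arc: an edge `e` together with one of the two signs, the sign being read with respect to the
reference orientation that the representing matrix provides. -/
abbrev Arc (E : Type*) := E × ℤˣ

/-- A fourientation is an arbitrary set of arcs. -/
abbrev Fourientation (E : Type*) := Set (Arc E)

/-- An orientation contains exactly one of the two arcs of each edge; it is recorded as the function
that assigns to each edge the sign of its arc. -/
abbrev Orientation (E : Type*) := E → ℤˣ

/-- The set of arcs of an orientation. -/
def Orientation.arcs {E : Type*} (O : Orientation E) : Set (Arc E) :=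
  {a | O a.1 = a.2}

/-- The set of arcs of a vector with entries in `{0, 1, -1}`. -/
def vecArcs {E : Type*} (v : E → ℝ) : Set (Arc E) :=
  {a | v a.1 = ((a.2 : ℤ) : ℝ)}

section

variable {m E : Type*} [Fintype m] [Fintype E]

/-- The columns of `A`, indexed by the ground set `E`, represent the matroid `M` over `ℝ`. -/
structure Represents (A : Matrix m E ℝ) (M : Matroid E) : Prop where
  ground_eq : M.E = univ
  indep_iff : ∀ I : Set E, M.Indep I ↔ LinearIndepOn ℝ A.col I

/-- Signed circuits: `{0, 1, -1}`-vectors in the kernel of `A` whose support is a circuit. -/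
structure IsSignedCircuit (M : Matroid E) (A : Matrix m E ℝ) (c : E → ℝ) : Prop where
  entries : ∀ e, c e = 0 ∨ c e = 1 ∨ c e = -1
  mem_ker : c ∈ LinearMap.ker A.mulVecLin
  support_isCircuit : M.IsCircuit (Function.support c)

/-- Signed cocircuits: `{0, 1, -1}`-vectors in the image of `Aᵀ` whose support is a cocircuit. -/
structure IsSignedCocircuit (M : Matroid E) (A : Matrix m E ℝ) (c : E → ℝ) : Prop where
  entries : ∀ e, c e = 0 ∨ c e = 1 ∨ c e = -1
  mem_range : c ∈ LinearMap.range A.transpose.mulVecLin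
  support_isCocircuit : M.IsCocircuit (Function.support c)

/-- A circuit signature: the choice of a signed circuit for each circuit. -/
structure CircuitSignature (M : Matroid E) (A : Matrix m E ℝ) where
  choice : {C : Set E // M.IsCircuit C} → (E → ℝ)
  isSigned : ∀ C, IsSignedCircuit M A (choice C)
  support_eq : ∀ C, Function.support (choice C) = C.1

/-- A cocircuit signature: the choice of a signed cocircuit for each cocircuit. -/
structure CocircuitSignature (M : Matroid E) (A : Matrix m E ℝ) where
  choice : {C : Set E // M.IsCocircuit C} → (E → ℝ)
  isSigned : ∀ C, IsSignedCocircuit M A (choice C)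
  support_eq : ∀ C, Function.support (choice C) = C.1

variable {M : Matroid E} {A : Matrix m E ℝ}

/-- The set of signed circuits chosen by a circuit signature. -/
def CircuitSignature.chosen (σ : CircuitSignature M A) : Set (E → ℝ) := range σ.choice

/-- The set of signed cocircuits chosen by a cocircuit signature. -/
def CocircuitSignature.chosen (σ : CocircuitSignature M A) : Set (E → ℝ) := range σ.choice

/-- The externally oriented basis that `σ` induces on `B`: both arcs of each edge of `B`, and, for
each edge `e` outside `B`, the arc of `e` in the signed circuit chosen for the fundamental circuit
of `e` with respect to `B`. -/
def CircuitSignature.orientedBasis (σ : CircuitSignature M A) (B : Set E) : Fourientation E :=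
  {a | a.1 ∈ B ∨ (a.1 ∉ B ∧
    ∃ h : M.IsCircuit (M.fundCircuit a.1 B), a ∈ vecArcs (σ.choice ⟨_, h⟩))}

/-- The internally oriented basis that `σ` induces on `B`: both arcs of each edge outside `B`, and,
for each edge `e` of `B`, the arc of `e` in the signed cocircuit chosen for the fundamental
cocircuit of `e` with respect to `B`. -/
def CocircuitSignature.orientedBasis (σ : CocircuitSignature M A) (B : Set E) : Fourientation E :=
  {a | a.1 ∉ B ∨ (a.1 ∈ B ∧
    ∃ h : M.IsCocircuit (M.fundCocircuit a.1 B), a ∈ vecArcs (σ.choice ⟨_, h⟩))}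

/-- The external atlas induced by a circuit signature. -/
def CircuitSignature.atlas (σ : CircuitSignature M A) : Set (Fourientation E) :=
  {F | ∃ B, M.IsBase B ∧ F = σ.orientedBasis B}

/-- The internal atlas induced by a cocircuit signature. -/
def CocircuitSignature.atlas (σ : CocircuitSignature M A) : Set (Fourientation E) :=
  {F | ∃ B, M.IsBase B ∧ F = σ.orientedBasis B}

/-- A circuit signature is triangulating if it contains every signed circuit that lies in some
externally oriented basis of its atlas. -/
def CircuitSignature.IsTriangulating (σ : CircuitSignature M A) : Prop :=
  ∀ F ∈ σ.atlas, ∀ c, IsSignedCircuit M A c → vecArcs c ⊆ F → c ∈ σ.chosen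

/-- A cocircuit signature is triangulating if it contains every signed cocircuit that lies in some
internally oriented basis of its atlas. -/
def CocircuitSignature.IsTriangulating (σ : CocircuitSignature M A) : Prop :=
  ∀ F ∈ σ.atlas, ∀ c, IsSignedCocircuit M A c → vecArcs c ⊆ F → c ∈ σ.chosen

/-- An orientation is compatible with a circuit signature if the signature contains every signed
circuit in the orientation. -/
def CircuitSignature.Compatible (σ : CircuitSignature M A) (O : Orientation E) : Prop :=
  ∀ c, IsSignedCircuit M A c → vecArcs c ⊆ O.arcs → c ∈ σ.chosen

/-- An orientation is compatible with a cocircuit signature if the signature contains every signed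
cocircuit in the orientation. -/
def CocircuitSignature.Compatible (σ : CocircuitSignature M A) (O : Orientation E) : Prop :=
  ∀ c, IsSignedCocircuit M A c → vecArcs c ⊆ O.arcs → c ∈ σ.chosen

/-- `O'` is obtained from `O` by replacing a signed circuit `c` in `O` by `-c`. -/
def CircuitReversal (M : Matroid E) (A : Matrix m E ℝ) (O O' : Orientation E) : Prop :=
  ∃ c, IsSignedCircuit M A c ∧ vecArcs c ⊆ O.arcs ∧
    O'.arcs = (O.arcs \ vecArcs c) ∪ vecArcs (-c)

/-- `O'` is obtained from `O` by replacing a signed cocircuit `c` in `O` by `-c`. -/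
def CocircuitReversal (M : Matroid E) (A : Matrix m E ℝ) (O O' : Orientation E) : Prop :=
  ∃ c, IsSignedCocircuit M A c ∧ vecArcs c ⊆ O.arcs ∧
    O'.arcs = (O.arcs \ vecArcs c) ∪ vecArcs (-c)

/-- The equivalence relation on orientations generated by circuit reversals. -/
def circuitSetoid (M : Matroid E) (A : Matrix m E ℝ) : Setoid (Orientation E) :=
  Relation.EqvGen.setoid (CircuitReversal M A)

/-- The equivalence relation on orientations generated by cocircuit reversals. -/
def cocircuitSetoid (M : Matroid E) (A : Matrix m E ℝ) : Setoid (Orientation E) :=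
  Relation.EqvGen.setoid (CocircuitReversal M A)

/-- The equivalence relation on orientations generated by circuit and cocircuit reversals. -/
def circuitCocircuitSetoid (M : Matroid E) (A : Matrix m E ℝ) : Setoid (Orientation E) :=
  Relation.EqvGen.setoid fun O O' => CircuitReversal M A O O' ∨ CocircuitReversal M A O O'

end

/-- `S` contains exactly one element of each equivalence class of `r`. -/
def IsRepresentativeSet {α : Type*} (r : Setoid α) (S : Set α) : Prop :=
  ∀ q : Quotient r, ∃! a, a ∈ S ∧ Quotient.mk r a = q

end RegularMatroid

/-! An orientation is a vertex of the cube $[-1,1]^E$, and reversing a signed circuit $c$ subtracts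
$2c$. Circuits and cocircuits are treated together: $V$ is the kernel of $A$ for the matroid, or the
row space of $A$ for its dual, and $S$ is the set of chosen vectors. By conformal decomposition
(`exists_conformal`), two orientations are linked by reversals exactly when they differ by a vector
of $V$ (`eqvGen_reversal`, `sub_mem_of_eqvGen`).

Uniqueness: a signed circuit conformal to the difference of two compatible orientations lies in one
of them and its negative in the other, so $S$ would contain both.

Existence: the image of the cube modulo $V$ is a zonotope, and a triangulating signature covers it
by cells indexed by bases $B$. In such a cell the coordinates outside $B$ are frozen at the signs
that $S$ prescribes, while those in $B$ vary in $[-1,1]$ (`exists_cell`). Applied to an orientation,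
this gives an equivalent point of the cube. Since signed circuits have entries in $\{0,\pm1\}$, that
point is again a vertex. It is compatible because a signed circuit in it agrees with $S$ outside
$B$.

For both kinds of reversal, the kernel and the row space are orthogonal. Hence circuit and cocircuit
changes have disjoint supports, commute, and preserve each other's compatibility. -/

namespace RegularMatroid

/-! ### Signatures on a subspace and conformal decomposition -/

section Abstract

variable {E : Type*}

/-- `{0, 1, -1}`-vectors of a subspace `V` whose support is a circuit of `N`. -/
structure IsSignedVec (N : Matroid E) (V : Submodule ℝ (E → ℝ)) (c : E → ℝ) : Prop where
  entries : ∀ e, c e = 0 ∨ c e = 1 ∨ c e = -1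
  mem : c ∈ V
  isCircuit : N.IsCircuit (Function.support c)

theorem IsSignedVec.neg {N : Matroid E} {V : Submodule ℝ (E → ℝ)} {c : E → ℝ}
    (hc : IsSignedVec N V c) : IsSignedVec N V (-c) where
  entries e := by rcases hc.entries e with h | h | h <;> simp [h]
  mem := V.neg_mem hc.mem
  isCircuit := by rw [Function.support_neg]; exact hc.isCircuit

/-- `S` is the set of vectors chosen by a signature of `N`, where the independent sets of `N` are
the sets that support no nonzero vector of `V`. -/
structure IsSignature (N : Matroid E) (V : Submodule ℝ (E → ℝ)) (S : Set (E → ℝ)) : Prop where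
  ground_eq : N.E = univ
  indep_iff : ∀ I, N.Indep I ↔ ∀ v ∈ V, Function.support v ⊆ I → v = 0
  signed : ∀ c ∈ S, IsSignedVec N V c
  exists_mem : ∀ C, N.IsCircuit C → ∃ c ∈ S, Function.support c = C
  neg_notMem : ∀ c ∈ S, -c ∉ S

/-- The triangulating property of a set of signed vectors. -/
def Triangulates (N : Matroid E) (V : Submodule ℝ (E → ℝ)) (S : Set (E → ℝ)) : Prop :=
  ∀ B, N.IsBase B → ∀ c, IsSignedVec N V c →
    (∀ e ∉ B, c e ≠ 0 → ∃ d ∈ S, Function.support d ⊆ insert e B ∧ d e = c e) → c ∈ S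

variable {N : Matroid E} {V : Submodule ℝ (E → ℝ)} {S : Set (E → ℝ)}

theorem IsSignedVec.eq_one_or {c : E → ℝ} (hc : IsSignedVec N V c) {e : E} (he : c e ≠ 0) :
    c e = 1 ∨ c e = -1 := (hc.entries e).resolve_left he

/-- Every vector of `V` has a conformal signed circuit through any element of its support. -/
theorem IsSignature.exists_conformal [Finite E] (h : IsSignature N V S) {v : E → ℝ} (hv : v ∈ V)
    {e : E} (he : v e ≠ 0) :
    ∃ c, IsSignedVec N V c ∧ c e ≠ 0 ∧ ∀ g, c g ≠ 0 → 0 < c g * v g := by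
  induction hn : (Function.support v).ncard using Nat.strong_induction_on generalizing v with
  | _ n ih =>
  subst hn
  have hdep : N.Dep (Function.support v) := by
    rw [Matroid.dep_iff, h.ground_eq]
    refine ⟨fun hi => he ?_, subset_univ _⟩
    rw [(h.indep_iff _).1 hi v hv subset_rfl]; rfl
  obtain ⟨C, hC, hCc⟩ := hdep.exists_isCircuit_subset
  obtain ⟨c₀, hc₀S, rfl⟩ := h.exists_mem C hCc
  have hc₀ := h.signed _ hc₀S
  by_cases hconf : ∃ c, IsSignedVec N V c ∧ c e ≠ 0 ∧ ∀ g, c g ≠ 0 → 0 < c g * v g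
  · exact hconf
  -- If no conformal circuit passes through `e`, then `c₀` or its negative does not oppose `v` at
  -- `e` but opposes it somewhere else.
  obtain ⟨c, hc, hsub, hce, g₀, hg₀⟩ : ∃ c, IsSignedVec N V c ∧
      Function.support c ⊆ Function.support v ∧ 0 ≤ c e * v e ∧ ∃ g, c g * v g < 0 := by
    have key : ∀ c, IsSignedVec N V c → Function.support c ⊆ Function.support v → c e ≠ 0 →
        0 ≤ c e * v e → ∃ c, IsSignedVec N V c ∧
        Function.support c ⊆ Function.support v ∧ 0 ≤ c e * v e ∧ ∃ g, c g * v g < 0 := by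
      intro c hc hcs hc0 hce
      by_contra! hno
      refine hconf ⟨c, hc, hc0, fun g hg => lt_of_le_of_ne ?_ (mul_ne_zero hg (hcs hg)).symm⟩
      exact hno c hc hcs hce g
    have hneg : Function.support (-c₀) ⊆ Function.support v := by rwa [Function.support_neg]
    by_cases h0 : c₀ e = 0
    · obtain ⟨g, hg⟩ := hc₀.isCircuit.nonempty
      rcases lt_or_gt_of_ne (mul_ne_zero hg (hC hg)) with hlt | hgt
      · exact ⟨c₀, hc₀, hC, by simp [h0], g, hlt⟩
      · exact ⟨-c₀, hc₀.neg, hneg, by simp [h0], g, by simpa using hgt⟩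
    · rcases le_total 0 (c₀ e * v e) with hle | hle
      · exact key c₀ hc₀ hC h0 hle
      · exact key (-c₀) hc₀.neg hneg (by simpa using h0) (by simpa using hle)
  -- The smallest `|v g|` among the opposing elements: adding that multiple of `c` cancels `g₁` and
  -- carries no coordinate of `v` past zero, so `w` is conformal to `v` with smaller support.
  obtain ⟨g₁, hg₁, hmin⟩ := Set.exists_min_image {g | c g * v g < 0} (fun g => |v g|)
    (Set.toFinite _) ⟨g₀, hg₀⟩
  have hg₁' : c g₁ * v g₁ < 0 := hg₁
  have hv₁ : v g₁ ≠ 0 := fun h0 => by simp [h0] at hg₁'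
  have ht : 0 < |v g₁| := abs_pos.2 hv₁
  set w : E → ℝ := v + |v g₁| • c with hw
  have hwg : ∀ g, w g = v g + |v g₁| * c g := fun g => by simp [hw]
  have hwv : ∀ g, w g ≠ 0 → 0 < w g * v g := by
    intro g hg
    rw [hwg] at hg ⊢
    rcases lt_or_ge (c g * v g) 0 with hlt | hge
    · have h1 := hmin g hlt
      rcases hc.entries g with h0 | h0 | h0
      · simp [h0] at hlt
      · rw [h0] at hg hlt ⊢
        have : v g < 0 := by linarith
        rw [abs_of_neg this] at h1
        have : v g + |v g₁| * 1 < 0 := lt_of_le_of_ne (by linarith) hg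
        nlinarith
      · rw [h0] at hg hlt ⊢
        have : 0 < v g := by linarith
        rw [abs_of_pos this] at h1
        have : 0 < v g + |v g₁| * -1 := lt_of_le_of_ne (by linarith) hg.symm
        nlinarith
    · have hvg : v g ≠ 0 := by
        intro h0
        have : c g = 0 := by
          by_contra hcg
          exact hsub hcg h0
        simp [h0, this] at hg
      have : 0 < v g * v g := mul_self_pos.2 hvg
      nlinarith
  have hwe : w e ≠ 0 := by
    have : 0 < v e * v e := mul_self_pos.2 he
    intro h0
    rw [hwg] at h0
    have h2 : (v e + |v g₁| * c e) * v e = 0 := by rw [h0, zero_mul]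
    nlinarith
  have hw₁ : w g₁ = 0 := by
    rw [hwg]
    rcases hc.entries g₁ with h0 | h0 | h0
    · simp [h0] at hg₁'
    · rw [h0] at hg₁' ⊢
      rw [abs_of_neg (by linarith)]; ring
    · rw [h0] at hg₁' ⊢
      rw [abs_of_pos (by linarith)]; ring
  have hss : Function.support w ⊂ Function.support v := by
    refine ⟨fun g hg h0 => ?_, fun hsup => hsup hv₁ hw₁⟩
    have := hwv g hg
    simp [h0] at this
  obtain ⟨c', hc', hc'e, hc'w⟩ := ih _ (Set.ncard_lt_ncard hss (Set.toFinite _))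
    (v := w) (V.add_mem hv (V.smul_mem _ hc.mem)) hwe rfl
  refine ⟨c', hc', hc'e, fun g hg => ?_⟩
  have h1 := hc'w g hg
  have hwg0 : w g ≠ 0 := fun h0 => by simp [h0] at h1
  have h2 := hwv g hwg0
  have h3 : 0 < w g * w g := mul_self_pos.2 hwg0
  have h4 := mul_pos h1 h2
  by_contra! h5
  nlinarith

/-- Two vectors of `V` supported on the same circuit are proportional: eliminating one element
leaves a vector supported on an independent set. Entries `1` and `-1` force the factor to be a sign.
-/
theorem IsSignature.mem_or_neg_mem (h : IsSignature N V S) {c : E → ℝ}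
    (hc : IsSignedVec N V c) : c ∈ S ∨ -c ∈ S := by
  obtain ⟨d, hdS, hd⟩ := h.exists_mem _ hc.isCircuit
  have hdV := h.signed d hdS
  obtain ⟨e, he⟩ := hc.isCircuit.nonempty
  have hde : d e ≠ 0 := by
    have : e ∈ Function.support d := hd ▸ he
    exact this
  have hci : N.Indep (Function.support c \ {e}) := hc.isCircuit.sdiff_singleton_indep he
  have hz : d e • c - c e • d = 0 := by
    refine (h.indep_iff _).1 hci _
      (V.sub_mem (V.smul_mem _ hc.mem) (V.smul_mem _ hdV.mem)) fun g hg => ⟨?_, ?_⟩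
    · intro h0
      have : d g = 0 := by
        by_contra h1
        have : g ∈ Function.support c := hd ▸ h1
        exact this h0
      simp [h0, this] at hg
    · rintro rfl
      simp [mul_comm] at hg
  have hz' : ∀ g, d e * c g = c e * d g := fun g => by
    have := congrFun hz g
    simp at this; linarith
  rcases hc.eq_one_or he with h1 | h1 <;> rcases hdV.eq_one_or hde with h2 | h2 <;>
    simp only [h1, h2] at hz'
  · left; convert hdS using 1; ext g; have := hz' g; linarith
  · right; convert hdS using 1; ext g; have := hz' g; simp; linarith
  · right; convert hdS using 1; ext g; have := hz' g; simp; linarith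
  · left; convert hdS using 1; ext g; have := hz' g; linarith

theorem IsSignature.exists_support_subset_insert [Finite E] (h : IsSignature N V S) {K : Set E}
    {e : E} (hK : N.Indep K) (he : ¬ N.Indep (insert e K)) :
    ∃ d ∈ S, Function.support d ⊆ insert e K ∧ d e ≠ 0 := by
  rw [h.indep_iff] at he
  push Not at he
  obtain ⟨u, hu, hus, hu0⟩ := he
  have hue : u e ≠ 0 := by
    intro h0
    refine hu0 ((h.indep_iff K).1 hK u hu fun g hg => ?_)
    rcases hus hg with rfl | hgK
    · exact absurd h0 hg
    · exact hgK
  obtain ⟨c, hc, hce, hcu⟩ := h.exists_conformal hu hue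
  have hcs : Function.support c ⊆ insert e K := fun g hg => hus fun h0 => by
    have := hcu g hg
    simp [h0] at this
  rcases h.mem_or_neg_mem hc with hm | hm
  · exact ⟨c, hm, hcs, hce⟩
  · exact ⟨-c, hm, by rwa [Function.support_neg], by simpa using hce⟩

/-- As `a` is an endpoint of $[-1,1]$, the difference `a - b` is zero or has the sign of `a`. This
turns conformality with a difference of points of the cube into equality of signs. -/
theorem IsSignedVec.eq_of_mul_sub_pos {c : E → ℝ} (hc : IsSignedVec N V c) {g : E} {a b : ℝ}
    (hpos : 0 < c g * (a - b)) (ha : a = 1 ∨ a = -1) (hb : |b| ≤ 1) : a = c g := by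
  rw [abs_le] at hb
  rcases hc.entries g with h | h | h <;> rcases ha with rfl | rfl <;> rw [h] at hpos ⊢ <;>
    linarith

/-- An element `e` of a signed circuit whose other elements are spanned by `B` is spanned by `B`. -/
theorem IsSignature.not_indep_insert (h : IsSignature N V S) {B : Set E} {c : E → ℝ} {e : E}
    (hB : N.Indep B) (heB : e ∉ B) (hc : IsSignedVec N V c) (hce : c e ≠ 0)
    (hsp : ∀ g, c g ≠ 0 → g ≠ e → g ∉ B → ∃ d ∈ S, Function.support d ⊆ insert g B ∧ d g ≠ 0) :
    ¬ N.Indep (insert e B) := by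
  have hBE : B ⊆ N.E := hB.subset_ground
  have hcl : Function.support c \ {e} ⊆ N.closure B := by
    rintro g ⟨hg, hge⟩
    by_cases hgB : g ∈ B
    · exact N.subset_closure B hBE hgB
    obtain ⟨d, hdS, hds, hdg⟩ := hsp g hg hge hgB
    refine N.closure_subset_closure ?_
      ((h.signed d hdS).isCircuit.mem_closure_sdiff_singleton_of_mem hdg)
    rintro k ⟨hk, hkg⟩
    exact (hds hk).resolve_left hkg
  have : e ∈ N.closure B :=
    N.closure_subset_closure_of_subset_closure hcl
      (hc.isCircuit.mem_closure_sdiff_singleton_of_mem hce)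
  intro hi
  exact (hB.notMem_closure_iff (by rw [h.ground_eq]; trivial)).2 ⟨hi, heB⟩ this

/-! ### Covering the zonotope by the cells of a triangulating signature -/

/-- The point of the zonotope of `T` modulo the span of `K` that `x` represents lies in the cell of
some basis. -/
theorem IsSignature.exists_cell [Finite E] (h : IsSignature N V S) (ht : Triangulates N V S)
    (T : Finset E) : ∀ K : Set E, N.Indep K → (∀ g ∈ T, g ∉ K) →
      ∀ x : E → ℝ, (∀ g, |x g| ≤ 1) →
      ∃ B, N.Indep B ∧ K ⊆ B ∧ ∃ x' : E → ℝ, (∀ g, |x' g| ≤ 1) ∧ ∃ v ∈ V,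
        (∀ g ∈ T, v g = x g - x' g) ∧ (∀ g ∉ T, g ∉ K → v g = 0) ∧
        ∀ g ∈ T, g ∉ B → ∃ d ∈ S, Function.support d ⊆ insert g B ∧ d g ≠ 0 ∧ d g = x' g := by
  classical
  -- The elements of `K` are contracted, so `v` is unconstrained there. A new element `e` is either
  -- contracted too, by passing to `insert e K`, or deleted, by keeping `K`.
  induction T using Finset.induction_on with
  | empty =>
    intro K hK _ x hx
    exact ⟨K, hK, subset_rfl, x, hx, 0, V.zero_mem, by simp, by simp, by simp⟩
  | insert e T heT ih =>
    intro K hK hTK x hx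
    have heK : e ∉ K := hTK e (Finset.mem_insert_self _ _)
    have hTK' : ∀ g ∈ T, g ∉ K := fun g hg => hTK g (Finset.mem_insert_of_mem hg)
    have hne : ∀ g ∈ T, g ≠ e := fun g hg hge => heT (hge ▸ hg)
    have hupd : ∀ (y : E → ℝ) (r : ℝ), (∀ g, |y g| ≤ 1) → |r| ≤ 1 →
        ∀ g, |Function.update y e r g| ≤ 1 := by
      intro y r hy hr g
      by_cases hge : g = e
      · subst hge; simpa using hr
      · simpa [hge] using hy g
    by_cases hKe : N.Indep (insert e K)
    · obtain ⟨B', hB', hKB', x', hx', v, hv, hvT, hv0, hd'⟩ := ih (insert e K) hKe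
        (fun g hg => by simp [hne g hg, hTK' g hg]) x hx
      have heB' : e ∈ B' := hKB' (mem_insert _ _)
      -- Contracting `e` leaves its coordinate free. If the value `x e - v e` lies in the allowed
      -- interval, the cell found for the contraction already serves.
      by_cases hl : |x e - v e| ≤ 1
      · refine ⟨B', hB', (subset_insert _ _).trans hKB', Function.update x' e (x e - v e),
          hupd _ _ hx' hl, v, hv, ?_, ?_, ?_⟩
        · intro g hg
          rcases Finset.mem_insert.1 hg with rfl | hg
          · simp
          · simpa [hne g hg] using hvT g hg
        · intro g hg hgK
          rw [Finset.mem_insert, not_or] at hg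
          exact hv0 g hg.2 (by simp [hg.1, hgK])
        · intro g hg hgB
          rcases Finset.mem_insert.1 hg with rfl | hg
          · exact absurd heB' hgB
          · simpa [hne g hg] using hd' g hg hgB
      obtain ⟨ε, hε, hεl⟩ : ∃ ε : ℝ, (ε = 1 ∨ ε = -1) ∧ 1 < ε * (x e - v e) := by
        rw [not_le, lt_abs] at hl
        rcases hl with hl | hl
        · exact ⟨1, Or.inl rfl, by linarith⟩
        · exact ⟨-1, Or.inr rfl, by linarith⟩
      have hxe := abs_le.1 (hx e)
      -- Otherwise the segment from `x` to `x - v` meets the facet where the coordinate at `e` is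
      -- `ε`, at time `t`. On `T` that point is the convex combination of `x` and `x'`, to which the
      -- induction hypothesis with `e` deleted applies.
      obtain ⟨t, ht0, ht1, hte⟩ : ∃ t : ℝ, 0 ≤ t ∧ t ≤ 1 ∧ t * v e = x e - ε := by
        rcases hε with rfl | rfl
        · have hneg : v e < 0 := by linarith
          refine ⟨(x e - 1) / v e, div_nonneg_of_nonpos (by linarith) hneg.le, ?_,
            div_mul_cancel₀ _ hneg.ne⟩
          rw [div_le_one_of_neg hneg]; linarith
        · have hpos : 0 < v e := by linarith
          refine ⟨(x e - -1) / v e, div_nonneg (by linarith) hpos.le, ?_,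
            div_mul_cancel₀ _ hpos.ne'⟩
          rw [div_le_one hpos]; linarith
      obtain ⟨B, hB, hKB, x₁, hx₁, v₁, hv₁, hv₁T, hv₁0, hd₁⟩ := ih K hK hTK'
        (fun g => (1 - t) * x g + t * x' g) (fun g => by
          have h1 := abs_le.1 (hx g)
          have h2 := abs_le.1 (hx' g)
          rw [abs_le]; constructor <;> nlinarith)
      have hv₁e : v₁ e = 0 := hv₁0 e heT heK
      have hsgn : e ∉ B → ∃ d ∈ S, Function.support d ⊆ insert e B ∧ d e ≠ 0 ∧ d e = ε := by
        -- Suppose `S` prescribes `-ε` at `e`. The vector `u` is `x₁ - x'` on `T` and has sign `-ε`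
        -- at `e`. A signed circuit `c` conformal to `u` through `e` then agrees with the signs
        -- prescribed by the cell of `B`, and `-c` with those of the cell of `B'`, where `e` is
        -- free. The triangulating property puts both in `S`.
        intro heB
        set u : E → ℝ := v - (t • v + v₁) with hu
        have huV : u ∈ V := V.sub_mem hv (V.add_mem (V.smul_mem _ hv) hv₁)
        have huT : ∀ g ∈ T, u g = x₁ g - x' g := by
          intro g hg
          have h1 := hvT g hg
          have h2 := hv₁T g hg
          simp only [hu, Pi.sub_apply, Pi.add_apply, Pi.smul_apply, smul_eq_mul, h1, h2]
          ring
        have hue : u e = v e - (x e - ε) := by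
          simp only [hu, Pi.sub_apply, Pi.add_apply, Pi.smul_apply, smul_eq_mul, hv₁e, hte]
          ring
        have hεu : ε * u e < 0 := by
          rw [hue]
          rcases hε with rfl | rfl <;> linarith
        have hu0 : ∀ g, g ∉ T → g ≠ e → g ∉ K → u g = 0 := by
          intro g hg hge hgK
          simp [hu, hv0 g hg (by simp [hge, hgK]), hv₁0 g hg hgK]
        obtain ⟨c, hc, hce, hcu⟩ := h.exists_conformal huV
          (show u e ≠ 0 from fun h0 => by simp [h0] at hεu)
        have hcT : ∀ g, c g ≠ 0 → g ≠ e → g ∉ K → g ∈ T := by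
          intro g hg hge hgK
          by_contra hgT
          have := hcu g hg
          simp [hu0 g hgT hge hgK] at this
        obtain ⟨d, hdS, hds, hde⟩ := h.exists_support_subset_insert hB
          (h.not_indep_insert hB heB hc hce fun g hg hge hgB => by
            obtain ⟨d, h1, h2, h3, -⟩ := hd₁ g (hcT g hg hge fun hgK => hgB (hKB hgK)) hgB
            exact ⟨d, h1, h2, h3⟩)
        refine ⟨d, hdS, hds, hde, ?_⟩
        by_contra hdε
        have hdc : d e = c e := by
          have h1 := hcu e hce
          rcases hε with rfl | rfl
          · have h2 := ((h.signed d hdS).eq_one_or hde).resolve_left hdε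
            rcases hc.eq_one_or hce with h3 | h3 <;> rw [h3] at h1 ⊢ <;> linarith
          · have h2 := ((h.signed d hdS).eq_one_or hde).resolve_right hdε
            rcases hc.eq_one_or hce with h3 | h3 <;> rw [h3] at h1 ⊢ <;> linarith
        obtain ⟨B₁, hB₁, hBB₁⟩ := hB.exists_isBase_superset
        obtain ⟨B₂, hB₂, hBB₂⟩ := hB'.exists_isBase_superset
        have hcS : c ∈ S := by
          refine ht B₁ hB₁ c hc fun g hgB hg => ?_
          by_cases hge : g = e
          · subst hge
            exact ⟨d, hdS, hds.trans (insert_subset_insert hBB₁), hdc⟩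
          have hgT := hcT g hg hge fun hgK => hgB (hBB₁ (hKB hgK))
          obtain ⟨f, hfS, hfs, hf0, hfg⟩ := hd₁ g hgT fun hgB' => hgB (hBB₁ hgB')
          refine ⟨f, hfS, hfs.trans (insert_subset_insert hBB₁), ?_⟩
          have h1 := hcu g hg
          rw [huT g hgT, ← hfg] at h1
          exact hc.eq_of_mul_sub_pos h1 ((h.signed f hfS).eq_one_or hf0) (hx' g)
        refine h.neg_notMem c hcS (ht B₂ hB₂ _ hc.neg fun g hgB hg => ?_)
        have hge : g ≠ e := fun hge => hgB (hge ▸ hBB₂ heB')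
        have hg' : c g ≠ 0 := by simpa using hg
        have hgT := hcT g hg' hge fun hgK => hgB (hBB₂ (hKB' (mem_insert_of_mem _ hgK)))
        obtain ⟨f, hfS, hfs, hf0, hfg⟩ := hd' g hgT fun hgB' => hgB (hBB₂ hgB')
        refine ⟨f, hfS, hfs.trans (insert_subset_insert hBB₂), ?_⟩
        have h1 := hcu g hg'
        rw [huT g hgT, ← hfg] at h1
        refine hc.neg.eq_of_mul_sub_pos (b := x₁ g) ?_ ((h.signed f hfS).eq_one_or hf0) (hx₁ g)
        simp only [Pi.neg_apply]; linarith
      refine ⟨B, hB, hKB, Function.update x₁ e ε,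
          hupd _ _ hx₁ (by rcases hε with rfl | rfl <;> simp), t • v + v₁,
          V.add_mem (V.smul_mem _ hv) hv₁, ?_, ?_, ?_⟩
      · intro g hg
        rcases Finset.mem_insert.1 hg with rfl | hg
        · simp [hv₁e, hte]
        · have h1 := hvT g hg
          have h2 := hv₁T g hg
          simp only [Pi.add_apply, Pi.smul_apply, smul_eq_mul, h1, h2, ne_eq, hne g hg,
            not_false_eq_true, Function.update_of_ne]
          ring
      · intro g hg hgK
        rw [Finset.mem_insert, not_or] at hg
        simp [hv0 g hg.2 (by simp [hg.1, hgK]), hv₁0 g hg.2 hgK]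
      · intro g hg hgB
        rcases Finset.mem_insert.1 hg with rfl | hg
        · simpa using hsgn hgB
        · simpa [hne g hg] using hd₁ g hg hgB
    -- Here `e` is a loop after contracting `K`. The chosen circuit `d` vanishes on `T`, so a
    -- multiple of it moves the coordinate at `e` to `d e` without affecting the cell found for `T`.
    · obtain ⟨d, hdS, hds, hde⟩ := h.exists_support_subset_insert hK hKe
      obtain ⟨B, hB, hKB, x', hx', v, hv, hvT, hv0, hd⟩ := ih K hK hTK' x hx
      have hd0 : ∀ g, g ≠ e → g ∉ K → d g = 0 := by
        intro g hge hgK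
        by_contra hg
        exact (hds hg).elim hge hgK
      refine ⟨B, hB, hKB, Function.update x' e (d e), hupd _ _ hx' ?_,
        v + ((x e - d e) / d e) • d, V.add_mem hv (V.smul_mem _ (h.signed d hdS).mem), ?_, ?_, ?_⟩
      · rcases (h.signed d hdS).eq_one_or hde with h1 | h1 <;> simp [h1]
      · intro g hg
        rcases Finset.mem_insert.1 hg with rfl | hg
        · simp [hv0 g heT heK, hde]
        · simp [hne g hg, hvT g hg, hd0 g (hne g hg) (hTK' g hg)]
      · intro g hg hgK
        rw [Finset.mem_insert, not_or] at hg
        simp [hv0 g hg.2 hgK, hd0 g hg.1 hgK]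
      · intro g hg hgB
        rcases Finset.mem_insert.1 hg with rfl | hg
        · exact ⟨d, hdS, hds.trans (insert_subset_insert hKB), hde, by simp⟩
        · simpa [hne g hg] using hd g hg hgB

end Abstract

/-! ### Orientations as vertices of the cube, and their reversal classes -/

/-- The `{1, -1}`-vector of an orientation. -/
def signVec {E : Type*} (O : Orientation E) : E → ℝ := fun e => ((O e : ℤ) : ℝ)

section Orientations

variable {E : Type*} {N : Matroid E} {V V' : Submodule ℝ (E → ℝ)} {S S' : Set (E → ℝ)}

theorem signVec_eq_or (O : Orientation E) (e : E) : signVec O e = 1 ∨ signVec O e = -1 := by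
  rcases Int.units_eq_one_or (O e) with h | h <;> simp [signVec, h]

theorem signVec_injective : Function.Injective (signVec (E := E)) := by
  intro O O' h
  ext e
  have := congrFun h e
  simpa [signVec] using this

theorem exists_signVec_eq {x : E → ℝ} (hx : ∀ e, x e = 1 ∨ x e = -1) :
    ∃ O : Orientation E, signVec O = x := by
  have : ∀ e, ∃ s : ℤˣ, ((s : ℤ) : ℝ) = x e := fun e => by
    rcases hx e with h | h
    · exact ⟨1, by simp [h]⟩
    · exact ⟨-1, by simp [h]⟩
  choose O hO using this
  exact ⟨O, funext hO⟩

theorem IsSignedVec.vecArcs_subset_iff {c : E → ℝ} (hc : IsSignedVec N V c) (O : Orientation E) :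
    vecArcs c ⊆ O.arcs ↔ ∀ e, c e ≠ 0 → c e = signVec O e := by
  constructor
  · intro h e he
    rcases hc.eq_one_or he with h1 | h1
    · have : ((e, 1) : Arc E) ∈ O.arcs := h (by simp [vecArcs, h1])
      have : O e = 1 := this
      simp [signVec, this, h1]
    · have : ((e, -1) : Arc E) ∈ O.arcs := h (by simp [vecArcs, h1])
      have : O e = -1 := this
      simp [signVec, this, h1]
  · rintro h ⟨e, s⟩ hes
    have hes : c e = ((s : ℤ) : ℝ) := hes
    have h1 := h e (by rw [hes]; simp)
    rw [hes, signVec] at h1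
    have : s = O e := Units.ext (by exact_mod_cast h1)
    exact this.symm

theorem arcs_eq_reversal_iff {c : E → ℝ} {O O' : Orientation E}
    (hc : ∀ e, c e ≠ 0 → c e = signVec O e) :
    O'.arcs = (O.arcs \ vecArcs c) ∪ vecArcs (-c) ↔ signVec O' = signVec O - (2 : ℝ) • c := by
  rw [Set.ext_iff, funext_iff, Prod.forall]
  refine forall_congr' fun e => ?_
  have h1 : ((-1 : ℝ) = 1) = False := by norm_num
  have h2 : ((1 : ℝ) = -1) = False := by norm_num
  have h3 : ((-1 : ℤˣ) = 1) = False := by simp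
  have h4 : ((1 : ℤˣ) = -1) = False := by simp
  have hc := hc e
  have hu : ∀ p : ℤˣ → Prop, (∀ s, p s) ↔ p 1 ∧ p (-1) := fun p =>
    ⟨fun h => ⟨h _, h _⟩, fun h s => by
      rcases Int.units_eq_one_or s with rfl | rfl
      exacts [h.1, h.2]⟩
  rw [hu]
  by_cases h0 : c e = 0
  · rcases Int.units_eq_one_or (O e) with h | h <;>
      rcases Int.units_eq_one_or (O' e) with h' | h' <;>
      simp [Orientation.arcs, vecArcs, signVec, h, h', h0, h1, h2, h3, h4]
  · have hc := hc h0
    rw [signVec] at hc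
    rcases Int.units_eq_one_or (O e) with h | h <;>
      rcases Int.units_eq_one_or (O' e) with h' | h' <;>
      rw [h] at hc <;> norm_num at hc <;>
      simp [Orientation.arcs, vecArcs, signVec, h, h', hc, h1, h2, h3, h4] <;> norm_num

/-- `O'` is obtained from `O` by reversing a signed circuit. -/
def Reversal (N : Matroid E) (V : Submodule ℝ (E → ℝ)) (O O' : Orientation E) : Prop :=
  ∃ c, IsSignedVec N V c ∧ vecArcs c ⊆ O.arcs ∧
    O'.arcs = (O.arcs \ vecArcs c) ∪ vecArcs (-c)

theorem reversal_iff {O O' : Orientation E} :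
    Reversal N V O O' ↔ ∃ c, IsSignedVec N V c ∧ (∀ e, c e ≠ 0 → c e = signVec O e) ∧
      signVec O' = signVec O - (2 : ℝ) • c := by
  refine exists_congr fun c => and_congr_right fun hc => ?_
  rw [hc.vecArcs_subset_iff]
  exact and_congr_right fun h => arcs_eq_reversal_iff h

theorem Reversal.sub_mem {O O' : Orientation E} (h : Reversal N V O O') :
    signVec O - signVec O' ∈ V := by
  obtain ⟨c, hc, -, h⟩ := reversal_iff.1 h
  rw [h, sub_sub_cancel]
  exact V.smul_mem _ hc.mem

/-- An orientation is compatible with `S` if all its signed circuits belong to `S`. -/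
def IsCompatible (N : Matroid E) (V : Submodule ℝ (E → ℝ)) (S : Set (E → ℝ))
    (O : Orientation E) : Prop :=
  ∀ c, IsSignedVec N V c → vecArcs c ⊆ O.arcs → c ∈ S

theorem eq_of_mul_signVec_sub_pos {c : E → ℝ} (hc : IsSignedVec N V c) {O O' : Orientation E}
    {e : E} (h : 0 < c e * (signVec O e - signVec O' e)) :
    c e = signVec O e ∧ -c e = signVec O' e := by
  have h1 : |signVec O e| ≤ 1 := by rcases signVec_eq_or O e with h | h <;> simp [h]
  have h2 : |signVec O' e| ≤ 1 := by rcases signVec_eq_or O' e with h | h <;> simp [h]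
  refine ⟨(hc.eq_of_mul_sub_pos h (signVec_eq_or O e) h2).symm,
    (hc.neg.eq_of_mul_sub_pos (b := signVec O e) ?_ (signVec_eq_or O' e) h1).symm⟩
  simp only [Pi.neg_apply]; linarith

/-- A signed circuit conformal to the difference lies in `O`, and reversing it makes `O` agree with
`O'` on its support. The difference keeps shrinking until it vanishes. -/
theorem IsSignature.eqvGen_reversal [Finite E] (h : IsSignature N V S) {O O' : Orientation E}
    (hO : signVec O - signVec O' ∈ V) : Relation.EqvGen (Reversal N V) O O' := by
  induction hn : (Function.support (signVec O - signVec O')).ncard using Nat.strong_induction_on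
    generalizing O with
  | _ n ih =>
  subst hn
  by_cases heq : signVec O - signVec O' = 0
  · rw [signVec_injective (sub_eq_zero.1 heq)]
    exact .refl _
  obtain ⟨e, he⟩ := Function.ne_iff.1 heq
  obtain ⟨c, hc, hce, hcv⟩ := h.exists_conformal hO he
  have hcO : ∀ g, c g ≠ 0 → c g = signVec O g ∧ -c g = signVec O' g := fun g hg =>
    eq_of_mul_signVec_sub_pos hc (hcv g hg)
  obtain ⟨O₁, hO₁⟩ := exists_signVec_eq (x := signVec O - (2 : ℝ) • c) fun g => by
    by_cases hg : c g = 0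
    · simpa [hg] using signVec_eq_or O g
    · have h1 := (hcO g hg).1
      rcases hc.eq_one_or hg with h2 | h2 <;> simp [← h1, h2] <;> norm_num
  have hR : Reversal N V O O₁ := reversal_iff.2 ⟨c, hc, fun g hg => (hcO g hg).1, hO₁⟩
  refine .trans _ _ _ (.rel _ _ hR) (ih _ (Set.ncard_lt_ncard ?_ (Set.toFinite _)) ?_ rfl)
  · have key : ∀ g, c g ≠ 0 → signVec O₁ g - signVec O' g = 0 := fun g hg => by
      have h1 := hcO g hg
      rw [hO₁]
      simp only [Pi.sub_apply, Pi.smul_apply, smul_eq_mul]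
      linarith
    refine ⟨fun g hg => ?_, fun hsup => hsup he (key e hce)⟩
    by_cases hcg : c g = 0
    · simpa [hO₁, hcg] using hg
    · exact absurd (key g hcg) hg
  · have := V.sub_mem hO hR.sub_mem
    simpa using this

theorem IsSignature.exists_isCompatible [Finite E] (h : IsSignature N V S)
    (ht : Triangulates N V S) (O : Orientation E) :
    ∃ O', IsCompatible N V S O' ∧ signVec O - signVec O' ∈ V := by
  classical
  cases nonempty_fintype E
  obtain ⟨B, hB, -, x', hx', v, hv, hvx, -, hd⟩ := h.exists_cell ht Finset.univ ∅ N.empty_indep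
    (by simp) (signVec O) (fun g => by rcases signVec_eq_or O g with h | h <;> simp [h])
  replace hvx : ∀ g, v g = signVec O g - x' g := fun g => hvx g (Finset.mem_univ _)
  replace hd : ∀ g, g ∉ B → ∃ d ∈ S, Function.support d ⊆ insert g B ∧ d g ≠ 0 ∧ d g = x' g :=
    fun g => hd g (Finset.mem_univ _)
  choose! d hdS hds hd0 hdx using hd
  -- Outside `B` both the old and the new coordinates are signs, so they differ by an even integer.
  have hev : ∀ g, g ∉ B → ∃ n : ℤ, v g * d g g = 2 * n := by
    intro g hg
    rw [hvx, ← hdx g hg]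
    rcases signVec_eq_or O g with h1 | h1 <;>
      rcases (h.signed _ (hdS g hg)).eq_one_or (hd0 g hg) with h2 | h2 <;> rw [h1, h2]
    · exact ⟨0, by norm_num⟩
    · exact ⟨-1, by norm_num⟩
    · exact ⟨-1, by norm_num⟩
    · exact ⟨0, by norm_num⟩
  choose! n hn using hev
  set s : Finset E := Finset.univ.filter (· ∉ B) with hs
  -- The vectors `d g` act as fundamental circuits: subtracting them clears every coordinate outside
  -- `B`, and the independent set `B` supports no nonzero vector of `V`. Thus evenness spreads from
  -- outside `B` to all of `v`.
  have hz : v - ∑ g ∈ s, (v g * d g g) • d g = 0 := by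
    refine (h.indep_iff B).1 hB _ (V.sub_mem hv (V.sum_mem fun g hg => V.smul_mem _
      (h.signed _ (hdS g (by simpa [hs] using hg))).mem)) fun k hk => ?_
    by_contra hkB
    refine hk ?_
    simp only [Pi.sub_apply, Finset.sum_apply, Pi.smul_apply, smul_eq_mul]
    rw [Finset.sum_eq_single k]
    · rcases (h.signed _ (hdS k hkB)).eq_one_or (hd0 k hkB) with h2 | h2 <;> rw [h2] <;> ring
    · intro g hg hgk
      have hgB : g ∉ B := by simpa [hs] using hg
      have : d g k = 0 := by
        by_contra h0
        exact (hds g hgB h0).elim hgk.symm hkB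
      rw [this, mul_zero]
    · intro hks
      exact absurd (by simpa [hs] using hkB) hks
  have hint : ∀ k, ∃ m : ℤ, v k = 2 * m := by
    intro k
    have : ∀ g, ∃ r : ℤ, g ∉ B → d g k = r := by
      intro g
      by_cases hgB : g ∈ B
      · exact ⟨0, fun h => absurd hgB h⟩
      rcases (h.signed _ (hdS g hgB)).entries k with h1 | h1 | h1
      · exact ⟨0, fun _ => by simp [h1]⟩
      · exact ⟨1, fun _ => by simp [h1]⟩
      · exact ⟨-1, fun _ => by simp [h1]⟩
    choose r hr using this
    refine ⟨∑ g ∈ s, n g * r g, ?_⟩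
    rw [sub_eq_zero.1 hz]
    simp only [Finset.sum_apply, Pi.smul_apply, smul_eq_mul]
    push_cast
    rw [Finset.mul_sum]
    refine Finset.sum_congr rfl fun g hg => ?_
    have hgB : g ∉ B := by simpa [hs] using hg
    rw [hn g hgB, hr g hgB]; ring
  -- A sign minus an even integer is odd, and the only odd integers in $[-1,1]$ are the two signs.
  obtain ⟨O', hO'⟩ := exists_signVec_eq (x := x') fun k => by
    obtain ⟨m, hm⟩ := hint k
    rw [hvx] at hm
    have h1 := abs_le.1 (hx' k)
    rcases signVec_eq_or O k with h2 | h2 <;> rw [h2] at hm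
    · have h3 : (-1 : ℝ) < m := by linarith
      have h4 : (m : ℝ) < 2 := by linarith
      have h5 : (-1 : ℤ) < m := by exact_mod_cast h3
      have h6 : m < 2 := by exact_mod_cast h4
      obtain rfl | rfl : m = 0 ∨ m = 1 := by omega
      · left; push_cast at hm; linarith
      · right; push_cast at hm; linarith
    · have h3 : (-2 : ℝ) < m := by linarith
      have h4 : (m : ℝ) < 1 := by linarith
      have h5 : (-2 : ℤ) < m := by exact_mod_cast h3
      have h6 : m < 1 := by exact_mod_cast h4
      obtain rfl | rfl : m = 0 ∨ m = -1 := by omega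
      · right; push_cast at hm; linarith
      · left; push_cast at hm; linarith
  refine ⟨O', fun c hc hcO => ?_, ?_⟩
  · rw [hc.vecArcs_subset_iff] at hcO
    obtain ⟨B₁, hB₁, hBB₁⟩ := hB.exists_isBase_superset
    refine ht B₁ hB₁ c hc fun g hg hcg => ?_
    have hgB : g ∉ B := fun h => hg (hBB₁ h)
    exact ⟨d g, hdS g hgB, (hds g hgB).trans (insert_subset_insert hBB₁),
      by rw [hcO g hcg, hO', hdx g hgB]⟩
  · convert hv using 1
    ext g
    simp [hvx, hO']

/-- Two orientations that differ by a vector of `V` are equal if the first is compatible and the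
second agrees with a compatible orientation wherever the two differ. -/
theorem IsSignature.eq_of_isCompatible [Finite E] (h : IsSignature N V S)
    {O O₁ O' : Orientation E} (hO : IsCompatible N V S O) (hO' : IsCompatible N V S O')
    (hV : signVec O - signVec O₁ ∈ V)
    (hagree : ∀ e, signVec O e ≠ signVec O₁ e → signVec O₁ e = signVec O' e) : O = O₁ := by
  by_contra hne
  obtain ⟨e, he⟩ := Function.ne_iff.1 (signVec_injective.ne hne)
  obtain ⟨c, hc, hce, hcv⟩ := h.exists_conformal hV (e := e) (sub_ne_zero.2 he)
  have hcO : ∀ g, c g ≠ 0 → c g = signVec O g ∧ -c g = signVec O₁ g := fun g hg =>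
    eq_of_mul_signVec_sub_pos hc (hcv g hg)
  refine h.neg_notMem c (hO c hc ((hc.vecArcs_subset_iff O).2 fun g hg => (hcO g hg).1))
    (hO' _ hc.neg ((hc.neg.vecArcs_subset_iff O').2 fun g hg => ?_))
  have hg : c g ≠ 0 := by simpa using hg
  have h1 := hcO g hg
  rw [Pi.neg_apply, h1.2]
  refine hagree g fun h2 => hg ?_
  linarith

theorem sub_mem_of_eqvGen {r : Orientation E → Orientation E → Prop}
    (hr : ∀ O O', r O O' → signVec O - signVec O' ∈ V) {O O' : Orientation E}
    (h : Relation.EqvGen r O O') : signVec O - signVec O' ∈ V := by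
  induction h with
  | rel _ _ h => exact hr _ _ h
  | refl => simp
  | symm x y _ h => rw [← neg_sub]; exact V.neg_mem h
  | trans x y z _ _ h h' => rw [← sub_add_sub_cancel _ (signVec y)]; exact V.add_mem h h'

theorem isRepresentativeSet_iff {α : Type*} (r : Setoid α) (s : Set α) :
    IsRepresentativeSet r s ↔
      (∀ a, ∃ b ∈ s, r a b) ∧ ∀ a ∈ s, ∀ b ∈ s, r a b → a = b := by
  constructor
  · intro h
    refine ⟨fun a => ?_, fun a ha b hb hab => ?_⟩
    · obtain ⟨b, ⟨hb, hba⟩, -⟩ := h (Quotient.mk r a)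
      exact ⟨b, hb, r.symm (Quotient.exact hba)⟩
    · exact (h (Quotient.mk r a)).unique ⟨ha, rfl⟩ ⟨hb, (Quotient.sound hab).symm⟩
  · rintro ⟨h1, h2⟩ q
    induction q using Quotient.inductionOn with
    | _ a =>
    obtain ⟨b, hb, hab⟩ := h1 a
    refine ⟨b, ⟨hb, (Quotient.sound hab).symm⟩, fun c ⟨hc, hca⟩ => ?_⟩
    exact h2 c hc b hb (r.trans (Quotient.exact hca) hab)

theorem IsSignature.isRepresentativeSet [Finite E] (h : IsSignature N V S)
    (ht : Triangulates N V S) :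
    IsRepresentativeSet (Relation.EqvGen.setoid (Reversal N V)) {O | IsCompatible N V S O} := by
  rw [isRepresentativeSet_iff]
  refine ⟨fun O => ?_, fun O hO O' hO' hOO' => ?_⟩
  · obtain ⟨O', hO', hV⟩ := h.exists_isCompatible ht O
    exact ⟨O', hO', h.eqvGen_reversal hV⟩
  · exact h.eq_of_isCompatible hO hO' (sub_mem_of_eqvGen (fun _ _ h => h.sub_mem) hOO')
      fun _ _ => rfl

/-! ### Commutation of reversals from orthogonal subspaces -/

section Orthogonal

variable [Fintype E]

/-- Differences of orientations in orthogonal subspaces have disjoint supports. -/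
theorem signVec_eq_or_eq_of_orthogonal (hV : ∀ v ∈ V, ∀ v' ∈ V', ∑ e, v e * v' e = 0)
    {O O₁ O' : Orientation E} (h : signVec O - signVec O₁ ∈ V)
    (h' : signVec O₁ - signVec O' ∈ V') (e : E) :
    signVec O e = signVec O₁ e ∨ signVec O₁ e = signVec O' e := by
  -- Among signs, two successive changes at one element must be opposite. All terms of the vanishing
  -- inner product are thus nonpositive, and each is zero.
  have hnp : ∀ e, (signVec O - signVec O₁) e * (signVec O₁ - signVec O') e ≤ 0 := by
    intro e
    simp only [Pi.sub_apply]
    rcases signVec_eq_or O e with h1 | h1 <;> rcases signVec_eq_or O₁ e with h2 | h2 <;>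
      rcases signVec_eq_or O' e with h3 | h3 <;> rw [h1, h2, h3] <;> norm_num
  have h0 := (Finset.sum_eq_zero_iff_of_nonpos fun e _ => hnp e).1 (hV _ h _ h') e
    (Finset.mem_univ _)
  rcases mul_eq_zero.1 h0 with h1 | h1
  · exact Or.inl (sub_eq_zero.1 h1)
  · exact Or.inr (sub_eq_zero.1 h1)

/-- The two changes have disjoint supports, so making the second one first still gives a sign
vector. -/
theorem exists_signVec_sub_mem_swap (hV : ∀ v ∈ V, ∀ v' ∈ V', ∑ e, v e * v' e = 0)
    {O O₁ O' : Orientation E} (h : signVec O - signVec O₁ ∈ V)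
    (h' : signVec O₁ - signVec O' ∈ V') :
    ∃ O₂ : Orientation E, signVec O - signVec O₂ ∈ V' ∧ signVec O₂ - signVec O' ∈ V := by
  obtain ⟨O₂, hO₂⟩ := exists_signVec_eq (x := signVec O - (signVec O₁ - signVec O')) fun e => by
    simp only [Pi.sub_apply]
    rcases signVec_eq_or_eq_of_orthogonal hV h h' e with h1 | h1
    · rw [h1, sub_sub_cancel]; exact signVec_eq_or _ _
    · rw [h1, sub_self, sub_zero]; exact signVec_eq_or _ _
  refine ⟨O₂, ?_, ?_⟩
  · rwa [hO₂, sub_sub_cancel]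
  · rw [hO₂]
    convert h using 1
    abel

/-- Swapping sorts any mixed chain of moves into one change along `V` followed by one along `V'`. -/
theorem exists_sub_mem_of_eqvGen (hV : ∀ v ∈ V, ∀ v' ∈ V', ∑ e, v e * v' e = 0)
    {r : Orientation E → Orientation E → Prop}
    (hr : ∀ O O', r O O' → signVec O - signVec O' ∈ V ∨ signVec O - signVec O' ∈ V')
    {O O' : Orientation E} (h : Relation.EqvGen r O O') :
    ∃ O₁ : Orientation E, signVec O - signVec O₁ ∈ V ∧ signVec O₁ - signVec O' ∈ V' := by
  have hV' : ∀ v' ∈ V', ∀ v ∈ V, ∑ e, v' e * v e = 0 := fun v' hv' v hv => by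
    simpa only [mul_comm] using hV v hv v' hv'
  induction h with
  | rel x y h =>
    rcases hr _ _ h with h | h
    · exact ⟨y, h, by simp⟩
    · exact ⟨x, by simp, h⟩
  | refl x => exact ⟨x, by simp, by simp⟩
  | symm x y _ h =>
    obtain ⟨z, hz, hz'⟩ := h
    refine exists_signVec_sub_mem_swap hV' (O₁ := z) ?_ ?_
    · rw [← neg_sub]; exact V'.neg_mem hz'
    · rw [← neg_sub]; exact V.neg_mem hz
  | trans x y z _ _ h h' =>
    obtain ⟨a, ha, ha'⟩ := h
    obtain ⟨b, hb, hb'⟩ := h'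
    obtain ⟨k, hk, hk'⟩ := exists_signVec_sub_mem_swap hV' ha' hb
    refine ⟨k, ?_, ?_⟩
    · rw [← sub_add_sub_cancel _ (signVec a)]; exact V.add_mem ha hk
    · rw [← sub_add_sub_cancel _ (signVec b)]; exact V'.add_mem hk' hb'

/-- Reversals from an orthogonal subspace do not affect compatibility. -/
theorem IsCompatible.of_orthogonal (hV : ∀ v ∈ V, ∀ v' ∈ V', ∑ e, v e * v' e = 0)
    {O O' : Orientation E} (hO : IsCompatible N V S O) (h : signVec O - signVec O' ∈ V') :
    IsCompatible N V S O' := by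
  intro c hc hcO'
  refine hO c hc ?_
  rw [hc.vecArcs_subset_iff] at hcO' ⊢
  have hnp : ∀ e, c e * (signVec O - signVec O') e ≤ 0 := by
    intro e
    by_cases hce : c e = 0
    · simp [hce]
    rw [hcO' e hce, Pi.sub_apply]
    rcases signVec_eq_or O e with h1 | h1 <;> rcases signVec_eq_or O' e with h2 | h2 <;>
      rw [h1, h2] <;> norm_num
  intro e hce
  have h0 := (Finset.sum_eq_zero_iff_of_nonpos fun e _ => hnp e).1 (hV _ hc.mem _ h) e
    (Finset.mem_univ _)
  rw [hcO' e hce, sub_eq_zero.1 ((mul_eq_zero.1 h0).resolve_left hce)]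

theorem IsSignature.isRepresentativeSet_or {N' : Matroid E} (h : IsSignature N V S)
    (h' : IsSignature N' V' S') (ht : Triangulates N V S) (ht' : Triangulates N' V' S')
    (hV : ∀ v ∈ V, ∀ v' ∈ V', ∑ e, v e * v' e = 0) :
    IsRepresentativeSet
      (Relation.EqvGen.setoid fun O O' => Reversal N V O O' ∨ Reversal N' V' O O')
      {O | IsCompatible N V S O ∧ IsCompatible N' V' S' O} := by
  rw [isRepresentativeSet_iff]
  refine ⟨fun O => ?_, fun O hO O' hO' hOO' => ?_⟩
  · obtain ⟨O₁, hO₁, hOO₁⟩ := h.exists_isCompatible ht O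
    obtain ⟨O₂, hO₂, hO₁₂⟩ := h'.exists_isCompatible ht' O₁
    exact ⟨O₂, ⟨hO₁.of_orthogonal hV hO₁₂, hO₂⟩, .trans _ _ _
      ((h.eqvGen_reversal hOO₁).mono fun _ _ => Or.inl)
      ((h'.eqvGen_reversal hO₁₂).mono fun _ _ => Or.inr)⟩
  · obtain ⟨O₁, h₁, h₂⟩ := exists_sub_mem_of_eqvGen hV
      (fun _ _ h => h.imp Reversal.sub_mem Reversal.sub_mem) hOO'
    -- Where `O` and `O₁` differ, `O₁` agrees with the compatible `O'`. This excludes the change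
    -- along `V` although `O₁` is not known to be compatible, and only the change along `V'`
    -- remains.
    have hdis := signVec_eq_or_eq_of_orthogonal hV h₁ h₂
    have e₁ : O = O₁ := h.eq_of_isCompatible hO.1 hO'.1 h₁ fun e he => (hdis e).resolve_left he
    subst e₁
    exact h'.eq_of_isCompatible hO.2 hO'.2 h₂ fun _ _ => rfl

end Orthogonal

end Orientations

/-! ### The kernel and the row space of the representing matrix -/

section Matrix

variable {m E : Type*} {M : Matroid E} {A : Matrix m E ℝ}

theorem isSignedCircuit_iff [Fintype E] {c : E → ℝ} :
    IsSignedCircuit M A c ↔ IsSignedVec M (LinearMap.ker A.mulVecLin) c :=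
  ⟨fun h => ⟨h.1, h.2, h.3⟩, fun h => ⟨h.1, h.2, h.3⟩⟩

theorem isSignedCocircuit_iff [Fintype m] {c : E → ℝ} :
    IsSignedCocircuit M A c ↔ IsSignedVec M✶ (LinearMap.range A.transpose.mulVecLin) c :=
  ⟨fun h => ⟨h.1, h.2, h.3⟩, fun h => ⟨h.1, h.2, h.3⟩⟩

theorem neg_notMem_range_of_support_eq {p : Set E → Prop} {f : {C : Set E // p C} → (E → ℝ)}
    (hp : ∀ C, p C → C.Nonempty) (hf : ∀ C, Function.support (f C) = C.1) (c : E → ℝ)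
    (hc : c ∈ range f) : -c ∉ range f := by
  rintro ⟨D, hD⟩
  obtain ⟨C, rfl⟩ := hc
  have h1 : D = C := Subtype.ext (by rw [← hf D, hD, Function.support_neg, hf C])
  subst h1
  obtain ⟨e, he⟩ := hp D.1 D.2
  rw [← hf D] at he
  have := congrFun hD e
  simp only [Pi.neg_apply] at this
  exact he (by linarith)

theorem Represents.indep_iff_ker [Fintype E] (hM : Represents A M) (I : Set E) :
    M.Indep I ↔ ∀ v ∈ LinearMap.ker A.mulVecLin, Function.support v ⊆ I → v = 0 := by
  classical
  rw [hM.indep_iff, linearIndepOn_iff]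
  constructor
  · intro h v hv hvI
    have := h (Finsupp.equivFunOnFinite.symm v)
      (by rw [Finsupp.mem_supported]; simpa using hvI) (by
        rw [LinearMap.mem_ker, Matrix.mulVecLin_apply, Matrix.mulVec_eq_sum] at hv
        rw [Finsupp.linearCombination_apply, Finsupp.sum_fintype _ _ (by simp)]
        simpa [Matrix.col] using hv)
    exact Finsupp.equivFunOnFinite.symm.injective (this.trans (by ext; simp))
  · intro h l hl hl0
    rw [Finsupp.mem_supported] at hl
    have := h l (by
      rw [LinearMap.mem_ker, Matrix.mulVecLin_apply, Matrix.mulVec_eq_sum]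
      rw [Finsupp.linearCombination_apply, Finsupp.sum_fintype _ _ (by simp)] at hl0
      simpa [Matrix.col] using hl0) (by rwa [Finsupp.fun_support_eq])
    exact DFunLike.coe_injective this

theorem Represents.dual_indep_iff_range [Fintype m] (hM : Represents A M) (I : Set E) :
    M✶.Indep I ↔
      ∀ v ∈ LinearMap.range A.transpose.mulVecLin, Function.support v ⊆ I → v = 0 := by
  classical
  have hE := hM.ground_eq
  constructor
  · intro hI v hv hvI
    obtain ⟨-, B, hB, hdisj⟩ := Matroid.dual_indep_iff_exists'.1 hI
    obtain ⟨y, rfl⟩ := hv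
    -- A row-space vector supported on `I` vanishes on a base `B` disjoint from `I`. Its coefficient
    -- vector `y` is then orthogonal to the columns of `B`, and these span all columns.
    have hBz : ∀ b ∈ B, A.col b ⬝ᵥ y = 0 := by
      intro b hb
      by_contra h0
      exact hdisj.le_bot ⟨hvI (show (A.transpose.mulVec y) b ≠ 0 from h0), hb⟩
    ext e
    change A.col e ⬝ᵥ y = 0
    have he : A.col e ∈ Submodule.span ℝ (A.col '' B) := by
      by_contra hne
      have hli := (hM.indep_iff B).1 hB.indep
      have heB : e ∉ B := fun h => hne (Submodule.subset_span ⟨e, h, rfl⟩)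
      have := (hM.indep_iff _).2 ((linearIndepOn_insert heB).2 ⟨hli, hne⟩)
      exact heB (hB.mem_of_insert_indep this)
    generalize A.col e = z at he
    induction he using Submodule.span_induction with
    | mem x hx => obtain ⟨b, hb, rfl⟩ := hx; exact hBz b hb
    | zero => simp
    | add x z _ _ hx hz => rw [add_dotProduct, hx, hz, add_zero]
    | smul a x _ hx => rw [smul_dotProduct, hx, smul_zero]
  · intro h
    obtain ⟨B, hB⟩ := M.exists_isBasis Iᶜ (by rw [hE]; exact subset_univ _)
    rw [Matroid.dual_indep_iff_exists']
    refine ⟨by rw [hE]; exact subset_univ _, B, ?_, ?_⟩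
    swap
    · exact (disjoint_compl_right_iff_subset.2 subset_rfl).mono_right hB.subset
    by_contra hnb
    obtain ⟨B', hB', hBB'⟩ := hB.indep.exists_isBase_superset
    obtain ⟨e, heB', heB⟩ := exists_of_ssubset (hBB'.ssubset_of_ne fun h => hnb (h ▸ hB'))
    have hli := (hM.indep_iff _).1 (hB'.indep.subset (insert_subset heB' hBB'))
    have hne := ((linearIndepOn_insert heB).1 hli).2
    -- If a basis `B` of the complement of `I` is not a base, some functional kills the columns of
    -- `B` but not column `e`. Its values on the columns form a nonzero row-space vector supported
    -- on `I`.
    obtain ⟨φ, hφe, hφ⟩ := Submodule.exists_le_ker_of_notMem hne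
    have hφA : ∀ g, (A.transpose.mulVec fun i => φ (Pi.single i 1)) g = φ (A.col g) := by
      intro g
      conv_rhs => rw [pi_eq_sum_univ' (A.col g), map_sum]
      simp [Matrix.mulVec, dotProduct]
    have h0 := h _ ⟨fun i => φ (Pi.single i 1), rfl⟩ (by
      intro g hg
      by_contra hgI
      refine hg ?_
      rw [Matrix.mulVecLin_apply, hφA]
      refine hφ ?_
      by_contra hgs
      have hgB : g ∉ B := fun h => hgs (Submodule.subset_span ⟨g, h, rfl⟩)
      have := (hM.indep_iff _).2
        ((linearIndepOn_insert hgB).2 ⟨(hM.indep_iff B).1 hB.indep, hgs⟩)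
      exact hgB (hB.mem_of_insert_indep hgI this))
    apply hφe
    rw [← hφA]
    exact congrFun h0 e

theorem sum_mul_eq_zero_of_mem_ker_of_mem_range [Fintype m] [Fintype E] (v : E → ℝ)
    (hv : v ∈ LinearMap.ker A.mulVecLin)
    (w : E → ℝ) (hw : w ∈ LinearMap.range A.transpose.mulVecLin) : ∑ e, v e * w e = 0 := by
  obtain ⟨y, rfl⟩ := hw
  change v ⬝ᵥ A.transpose.mulVec y = 0
  rw [Matrix.dotProduct_mulVec, Matrix.vecMul_transpose]
  rw [LinearMap.mem_ker, Matrix.mulVecLin_apply] at hv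
  rw [hv, zero_dotProduct]

theorem CircuitSignature.isSignature [Fintype E] (σ : CircuitSignature M A) (hM : Represents A M) :
    IsSignature M (LinearMap.ker A.mulVecLin) σ.chosen where
  ground_eq := hM.ground_eq
  indep_iff := hM.indep_iff_ker
  signed := by rintro _ ⟨C, rfl⟩; exact isSignedCircuit_iff.1 (σ.isSigned C)
  exists_mem C hC := ⟨_, ⟨⟨C, hC⟩, rfl⟩, σ.support_eq _⟩
  neg_notMem := neg_notMem_range_of_support_eq (fun _ h => h.nonempty) σ.support_eq

theorem CocircuitSignature.isSignature [Fintype m] (σ : CocircuitSignature M A)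
    (hM : Represents A M) :
    IsSignature M✶ (LinearMap.range A.transpose.mulVecLin) σ.chosen where
  ground_eq := hM.ground_eq
  indep_iff := hM.dual_indep_iff_range
  signed := by rintro _ ⟨C, rfl⟩; exact isSignedCocircuit_iff.1 (σ.isSigned C)
  exists_mem C hC := ⟨_, ⟨⟨C, hC⟩, rfl⟩, σ.support_eq _⟩
  neg_notMem := neg_notMem_range_of_support_eq (fun _ h => h.nonempty) σ.support_eq

theorem CircuitSignature.IsTriangulating.triangulates [Fintype E] {σ : CircuitSignature M A}
    (hσ : σ.IsTriangulating) : Triangulates M (LinearMap.ker A.mulVecLin) σ.chosen := by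
  intro B hB c hc hcB
  refine hσ _ ⟨B, hB, rfl⟩ c (isSignedCircuit_iff.2 hc) ?_
  rintro ⟨e, s⟩ (hes : c e = _)
  by_cases he : e ∈ B
  · exact Or.inl he
  refine Or.inr ⟨he, ?_⟩
  obtain ⟨_, ⟨C, rfl⟩, hds, hde⟩ := hcB e he (by rw [hes]; simp)
  rw [σ.support_eq] at hds
  have hC : C.1 = M.fundCircuit e B := C.2.eq_fundCircuit_of_subset hB.indep hds
  obtain ⟨C, hCc⟩ := C
  subst hC
  exact ⟨hCc, hde.trans hes⟩

theorem CocircuitSignature.IsTriangulating.triangulates [Fintype m] {σ : CocircuitSignature M A}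
    (hσ : σ.IsTriangulating) (hM : Represents A M) :
    Triangulates M✶ (LinearMap.range A.transpose.mulVecLin) σ.chosen := by
  intro B hB c hc hcB
  have hE : M.E = univ := hM.ground_eq
  -- Bases of the dual are complements of bases, which matches fundamental circuits of the dual with
  -- fundamental cocircuits.
  have hB' : M.IsBase Bᶜ := by
    have := hB.compl_isBase_of_dual
    rwa [hE, ← compl_eq_univ_sdiff] at this
  refine hσ _ ⟨Bᶜ, hB', rfl⟩ c (isSignedCocircuit_iff.2 hc) ?_
  rintro ⟨e, s⟩ (hes : c e = _)
  by_cases he : e ∈ B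
  · exact Or.inl (not_not_intro he)
  refine Or.inr ⟨he, ?_⟩
  obtain ⟨_, ⟨C, rfl⟩, hds, hde⟩ := hcB e he (by rw [hes]; simp)
  rw [σ.support_eq] at hds
  have hC : C.1 = M.fundCocircuit e Bᶜ := by
    rw [Matroid.fundCocircuit, Matroid.dual_ground, hE, ← compl_eq_univ_sdiff, compl_compl]
    exact Matroid.IsCircuit.eq_fundCircuit_of_subset C.2 hB.indep hds
  obtain ⟨C, hCc⟩ := C
  subst hC
  exact ⟨hCc, hde.trans hes⟩

theorem circuitReversal_eq [Fintype E] :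
    CircuitReversal M A = Reversal M (LinearMap.ker A.mulVecLin) := by
  ext O O'
  simp only [CircuitReversal, Reversal, isSignedCircuit_iff]

theorem cocircuitReversal_eq [Fintype m] :
    CocircuitReversal M A = Reversal M✶ (LinearMap.range A.transpose.mulVecLin) := by
  ext O O'
  simp only [CocircuitReversal, Reversal, isSignedCocircuit_iff]

theorem CircuitSignature.compatible_iff [Fintype E] (σ : CircuitSignature M A) (O : Orientation E) :
    σ.Compatible O ↔ IsCompatible M (LinearMap.ker A.mulVecLin) σ.chosen O := by
  simp only [CircuitSignature.Compatible, IsCompatible, isSignedCircuit_iff]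

theorem CocircuitSignature.compatible_iff [Fintype m] (σ : CocircuitSignature M A)
    (O : Orientation E) :
    σ.Compatible O ↔ IsCompatible M✶ (LinearMap.range A.transpose.mulVecLin) σ.chosen O := by
  simp only [CocircuitSignature.Compatible, IsCompatible, isSignedCocircuit_iff]

end Matrix

end RegularMatroid

theorem proposition1p14 {m E : Type*} [Fintype m] [Fintype E]
    (M : Matroid E) (A : Matrix m E ℝ)
    (hA : A.IsTotallyUnimodular) (hM : RegularMatroid.Represents A M) :
    (∀ (σ : RegularMatroid.CircuitSignature M A) (σ' : RegularMatroid.CocircuitSignature M A),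
      σ.IsTriangulating → σ'.IsTriangulating →
        RegularMatroid.IsRepresentativeSet (RegularMatroid.circuitCocircuitSetoid M A)
          {O | σ.Compatible O ∧ σ'.Compatible O}) ∧
    (∀ σ : RegularMatroid.CircuitSignature M A, σ.IsTriangulating →
      RegularMatroid.IsRepresentativeSet (RegularMatroid.circuitSetoid M A)
        {O | σ.Compatible O}) ∧
    (∀ σ' : RegularMatroid.CocircuitSignature M A, σ'.IsTriangulating →
      RegularMatroid.IsRepresentativeSet (RegularMatroid.cocircuitSetoid M A)
        {O | σ'.Compatible O}) := by
  refine ⟨fun σ σ' hσ hσ' => ?_, fun σ hσ => ?_, fun σ' hσ' => ?_⟩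
  · simp only [RegularMatroid.circuitCocircuitSetoid, RegularMatroid.circuitReversal_eq,
      RegularMatroid.cocircuitReversal_eq, σ.compatible_iff, σ'.compatible_iff]
    exact (σ.isSignature hM).isRepresentativeSet_or (σ'.isSignature hM) hσ.triangulates
      (hσ'.triangulates hM) RegularMatroid.sum_mul_eq_zero_of_mem_ker_of_mem_range
  · simp only [RegularMatroid.circuitSetoid, RegularMatroid.circuitReversal_eq, σ.compatible_iff]
    exact (σ.isSignature hM).isRepresentativeSet hσ.triangulates
  · simp only [RegularMatroid.cocircuitSetoid, RegularMatroid.cocircuitReversal_eq,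
      σ'.compatible_iff]
    exact (σ'.isSignature hM).isRepresentativeSet (hσ'.triangulates hM)
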